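/- Let $(X,d)$ be a countable compact metric space. Put $X^{(0)}=X$, let $X^{(\beta+1)}$ be the set of accumulation points of $X^{(\beta)}$, and let $X^{(\lambda)}=\bigcap_{\beta<\lambda}X^{(\beta)}$ for limit ordinals $\lambda$. Suppose that $X$ has derived degree $\alpha$, that is, $X^{(\alpha)}\neq\emptyset$ and $X^{(\alpha+1)}=\emptyset$, where $\alpha>\omega$ (the first infinite ordinal) is not a limit ordinal. Let $n\ge 1$ be an integer. Let $\mathcal H(X)$ be the set of homeomorphisms of $X$ onto itself with the metric $D(T_1,T_2)=\max_{x\in X} d(T_1x,T_2x)$, and let $\mathcal E_n(X)$ be the set of $n$-expansive $T\in\mathcal H(X)$, that is, those for which there is $\delta>0$ such that for every $x\in X$ the set $\{y\in X : d(T^kx,T^ky)\le\delta \text{ for all } k\in\mathbb Z\}$ has at most $n$ elements. Then $\overline{\mathcal E_n(X)}\neq\mathcal H(X)$; that is, the $n$-expansive homeomorphisms are not dense in $\mathcal H(X)$. -/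

import Mathlib

/-- The set `𝓗(X)` of homeomorphisms of a compact metric space `X` onto itself, metrized by
`D(T, S) = sup_x d(T x, S x)`. The supremum is attained, since `X` is compact, when `X` is
nonempty. -/
noncomputable instance homeomorphSupMetric {X : Type*} [MetricSpace X] [CompactSpace X] :
    MetricSpace (X ≃ₜ X) where
  dist T S := ⨆ x, dist (T x) (S x)
  dist_self T := by simp
  dist_comm T S := by simp only [dist_comm]
  dist_triangle T S R := by
    have hb : ∀ F G : X ≃ₜ X, BddAbove (Set.range fun x => dist (F x) (G x)) := fun F G =>
      (isCompact_range (F.continuous.dist G.continuous)).bddAbove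
    have hn : ∀ F G : X ≃ₜ X, 0 ≤ ⨆ x, dist (F x) (G x) := fun F G =>
      Real.iSup_nonneg fun x => dist_nonneg
    refine Real.iSup_le (fun x => ?_) (add_nonneg (hn T S) (hn S R))
    exact (dist_triangle (T x) (S x) (R x)).trans
      (add_le_add (le_ciSup (hb T S) x) (le_ciSup (hb S R) x))
  eq_of_dist_eq_zero := by
    intro T S h
    ext x
    have hb : BddAbove (Set.range fun x => dist (T x) (S x)) :=
      (isCompact_range (T.continuous.dist S.continuous)).bddAbove
    have hx : dist (T x) (S x) ≤ ⨆ x, dist (T x) (S x) := le_ciSup hb x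
    exact dist_le_zero.1 (hx.trans h.le)

/-- The set `Γ_δ[x, T]` of the points whose full orbit under `T` stays within distance `δ` of the
orbit of `x`. -/
def companionSet {X : Type*} [MetricSpace X] (T : X ≃ₜ X) (δ : ℝ) (x : X) : Set X :=
  {y | ∀ k : ℤ, dist ((T ^ k) x) ((T ^ k) y) ≤ δ}

/-- `T` is `n`-expansive: for some `δ > 0` every `Γ_δ[x, T]` has at most `n` elements. -/
def IsNExpansive {X : Type*} [MetricSpace X] (n : ℕ) (T : X ≃ₜ X) : Prop :=
  ∃ δ : ℝ, 0 < δ ∧ ∀ x : X, (companionSet T δ x).encard ≤ n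

/-- The set `𝓔_n(X)` of the `n`-expansive homeomorphisms of `X`. -/
def nExpansiveHomeos (X : Type*) [MetricSpace X] (n : ℕ) : Set (X ≃ₜ X) :=
  {T | IsNExpansive n T}

/-- `d(X) = α`: the derived set of `X` of order `α` is nonempty and that of order `α + 1` is
empty. -/
def HasDerivedDegree (X : Type*) [TopologicalSpace X] (α : Ordinal) : Prop :=
  (CantorBendixson.iteratedDerivedSet (Set.univ : Set X) α).Nonempty ∧
    CantorBendixson.iteratedDerivedSet (Set.univ : Set X) (α + 1) = ∅

open CantorBendixson Filter Topology

/-! A whole ball around the identity misses the `n`-expansive maps. Isolate a point `p` of `X^(ω)`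
in a clopen `U`. Any `S` close to the identity preserves `U`, hence fixes `p` and preserves each
`X^(b) ∩ U`. For `b < ω` these sets are infinite and shrink to `p`, so one of them lies in
`companionSet S δ p`, however small `δ` is. -/

/-- Homeomorphisms preserve the iterated derived sets of the space. -/
theorem apply_mem_iteratedDerivedSet {X : Type*} [TopologicalSpace X] (T : X ≃ₜ X)
    (a : Ordinal) {x : X} (hx : x ∈ iteratedDerivedSet (Set.univ : Set X) a) :
    T x ∈ iteratedDerivedSet (Set.univ : Set X) a := by
  induction a using Ordinal.limitRecOn generalizing x with
  | zero => simp
  | add_one a ih =>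
    rw [iteratedDerivedSet_succ, relDerivedSet] at hx ⊢
    refine ⟨?_, ih hx.2⟩
    have h : AccPt (T x) (map T (𝓟 (iteratedDerivedSet Set.univ a))) :=
      AccPt.map hx.1 T.continuous.continuousAt T.injective
    exact h.mono (by rw [map_principal, le_principal_iff, mem_principal]
                     rintro _ ⟨y, hy, rfl⟩
                     exact ih hy)
  | limit a ha ih =>
    rw [iteratedDerivedSet_limit ha, Set.mem_iInter] at hx ⊢
    exact fun b => ih b.1 b.2 (hx b)

/-- A derived set whose order is at most the derived degree of the space has an isolated point. -/
theorem HasDerivedDegree.exists_isolated {X : Type*} [TopologicalSpace X] {α a : Ordinal}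
    (hX : HasDerivedDegree X α) (ha : a ≤ α) :
    ∃ p ∈ iteratedDerivedSet (Set.univ : Set X) a,
      ¬ AccPt p (𝓟 (iteratedDerivedSet (Set.univ : Set X) a)) := by
  by_contra! h
  -- Without isolated points the derivation stops at order `a`, so this set is the perfect kernel
  -- and lies in the empty set of order `α + 1`.
  have hfix : iteratedDerivedSet (Set.univ : Set X) a ∈ Function.fixedPoints relDerivedSet :=
    mem_fixedPoints_of_iteratedDerivedSet_succ_eq
      (by rw [iteratedDerivedSet_succ]
          exact Set.Subset.antisymm relDerivedSet_subset fun p hp => ⟨h p hp, hp⟩)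
  obtain ⟨q, hq⟩ := hX.1
  have hq' : q ∈ iteratedDerivedSet (Set.univ : Set X) (α + 1) :=
    perfectKernel_subset_iteratedDerivedSet _ _
      (perfectKernel_eq_iteratedDerivedSet_of_mem_fixedPoints hfix ▸
        iteratedDerivedSet_antitone _ ha hq)
  rw [hX.2] at hq'
  exact hq'

/-- The integer powers of a homeomorphism preserve every set that it preserves in both
directions. -/
theorem Homeomorph.zpow_apply_mem_iff {X : Type*} [TopologicalSpace X] (S : X ≃ₜ X) {U : Set X}
    (hU : ∀ x, S x ∈ U ↔ x ∈ U) (k : ℤ) (x : X) : (S ^ k) x ∈ U ↔ x ∈ U := by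
  induction k generalizing x with
  | zero => simp
  | succ k ih => rw [zpow_add_one, Homeomorph.mul_apply, ih, hU]
  | pred k ih =>
    rw [zpow_sub_one, Homeomorph.mul_apply, ih, ← hU, ← Homeomorph.mul_apply, mul_inv_cancel,
      Homeomorph.one_apply]

/-- A homeomorphism preserving a clopen set that contains exactly one point of the derived set of
limit order `l` is not `n`-expansive. -/
theorem not_isNExpansive_of_inter_eq_singleton {X : Type*} [MetricSpace X] [CompactSpace X]
    {l : Ordinal} (hl : Order.IsSuccLimit l) {U : Set X} (hU : IsClopen U) {p : X}
    (hp : iteratedDerivedSet (Set.univ : Set X) l ∩ U = {p}) {S : X ≃ₜ X}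
    (hS : ∀ x, S x ∈ U ↔ x ∈ U) (n : ℕ) : ¬ IsNExpansive n S := by
  rintro ⟨δ, hδ, h⟩
  obtain ⟨hpl, hpU⟩ : p ∈ iteratedDerivedSet (Set.univ : Set X) l ∩ U := hp ▸ rfl
  -- Compactness: these closed sets decrease to `{p}` as `b` tends to `l`.
  obtain ⟨b, hb, hbδ⟩ : ∃ b < l,
      iteratedDerivedSet (Set.univ : Set X) b ∩ U ⊆ Metric.ball p δ := by
    have : Nonempty (Set.Iio l) := ⟨⟨0, hl.bot_lt⟩⟩
    have hcl (b : Set.Iio l) : IsClosed (iteratedDerivedSet (Set.univ : Set X) b.1 ∩ U) :=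
      (isClosed_iteratedDerivedSet isClosed_univ _).inter hU.isClosed
    obtain ⟨b, hb⟩ := exists_subset_nhds_of_isCompact'
      (V := fun b : Set.Iio l => iteratedDerivedSet (Set.univ : Set X) b.1 ∩ U)
      (directed_of_isDirected_le fun b c hbc =>
        Set.inter_subset_inter_left _ (iteratedDerivedSet_antitone _ hbc))
      (fun b => (hcl b).isCompact) hcl (U := Metric.ball p δ) (by
        intro x hx
        rw [← Set.iInter_inter, ← iteratedDerivedSet_limit hl, hp, Set.mem_singleton_iff] at hx
        exact hx ▸ Metric.ball_mem_nhds p hδ)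
    exact ⟨b, b.2, hb⟩
  have hfix (k : ℤ) : (S ^ k) p = p := by
    have hk : (S ^ k) p ∈ iteratedDerivedSet (Set.univ : Set X) l ∩ U :=
      ⟨apply_mem_iteratedDerivedSet (S ^ k) l hpl, (S.zpow_apply_mem_iff hS k p).2 hpU⟩
    rwa [hp] at hk
  have hsub : iteratedDerivedSet (Set.univ : Set X) b ∩ U ⊆ companionSet S δ p := by
    intro y hy k
    rw [hfix, dist_comm]
    exact (Metric.mem_ball.1 (hbδ ⟨apply_mem_iteratedDerivedSet (S ^ k) b hy.1,
      (S.zpow_apply_mem_iff hS k y).2 hy.2⟩)).le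
  -- As `l` is a limit, `b + 1 < l`, so `p` survives one more derivation.
  have hacc : AccPt p (𝓟 (iteratedDerivedSet (Set.univ : Set X) b)) := by
    have hp' := iteratedDerivedSet_antitone _ (hl.add_one_lt hb).le hpl
    rw [iteratedDerivedSet_succ] at hp'
    exact hp'.1
  have hinf : (iteratedDerivedSet (Set.univ : Set X) b ∩ U).Infinite := by
    rw [Set.inter_comm]
    exact Set.Infinite.of_accPt (hacc.nhds_inter (hU.isOpen.mem_nhds hpU))
  have htop : (companionSet S δ p).encard = ⊤ := (hinf.mono hsub).encard_eq
  exact absurd (htop ▸ h p) (by simp)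

/-- Homeomorphisms close to the identity preserve a given clopen set. -/
theorem IsClopen.exists_forall_dist_one_lt {X : Type*} [MetricSpace X] [CompactSpace X]
    {U : Set X} (hU : IsClopen U) :
    ∃ ε > 0, ∀ S : X ≃ₜ X, dist (1 : X ≃ₜ X) S < ε → ∀ x, S x ∈ U ↔ x ∈ U := by
  -- The indicator of `U` takes only the values 0 and 1, so a variation below 1 means none.
  obtain ⟨ε, hε, h⟩ := Metric.uniformContinuous_iff.1
    (CompactSpace.uniformContinuous_of_continuous
      (hU.continuous_indicator (continuous_const (y := (1 : ℝ))))) 1 one_pos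
  refine ⟨ε, hε, fun S hS x => ?_⟩
  have hb : BddAbove (Set.range fun x => dist ((1 : X ≃ₜ X) x) (S x)) :=
    (isCompact_range ((1 : X ≃ₜ X).continuous.dist S.continuous)).bddAbove
  have hx : dist x (S x) < ε := (le_ciSup hb x).trans_lt hS
  have := h hx
  by_cases h₁ : x ∈ U <;> by_cases h₂ : S x ∈ U <;> simp_all

theorem mainTheorem11 {X : Type*} [MetricSpace X] [CompactSpace X] [Countable X]
    (α : Ordinal) (hX : HasDerivedDegree X α) (hlim : ¬ Order.IsSuccLimit α)
    (hα : Ordinal.omega0 < α) (n : ℕ) (hn : 1 ≤ n) :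
    closure (nExpansiveHomeos X n) ≠ (Set.univ : Set (X ≃ₜ X)) := by
  obtain ⟨p, hp, hacc⟩ := hX.exists_isolated hα.le
  obtain ⟨V, hV, hpV⟩ : ∃ V ∈ 𝓝 p, ∀ y ∈ V ∩ iteratedDerivedSet Set.univ Ordinal.omega0,
      y = p := by
    rw [accPt_iff_nhds] at hacc
    push Not at hacc
    exact hacc
  have : TotallyDisconnectedSpace X := ⟨Set.countable_univ.isTotallyDisconnected⟩
  obtain ⟨U, ⟨hpU, hU⟩, hUV⟩ := (nhds_basis_clopen p).mem_iff.1 hV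
  have hsing : iteratedDerivedSet (Set.univ : Set X) Ordinal.omega0 ∩ U = {p} := by
    ext y
    refine ⟨fun hy => hpV y ⟨hUV hy.2, hy.1⟩, ?_⟩
    rintro rfl
    exact ⟨hp, hpU⟩
  obtain ⟨ε, hε, hS⟩ := hU.exists_forall_dist_one_lt
  intro h
  obtain ⟨S, hSn, hSε⟩ := Metric.mem_closure_iff.1 (h ▸ Set.mem_univ (1 : X ≃ₜ X)) ε hε
  exact not_isNExpansive_of_inter_eq_singleton Ordinal.isSuccLimit_omega0 hU hsing (hS S hSε) n hSn
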